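/- For $b_1,\dots,b_n>0$ let $E^{2n}(b_1,\dots,b_n)=\{z\in\mathbb C^n : \sum_{i=1}^n \pi|z_i|^2/b_i<1\}$ be the open symplectic ellipsoid, and for $b>0$ let $B^{2n}(b)=E^{2n}(b,\dots,b)$ be the open ball. Both carry the standard symplectic form $\omega_0=\sum_{i=1}^n dx_i\wedge dy_i$, where $z_i=x_i+iy_i$. For open $U,V\subset\mathbb C^n$, we say that $U$ symplectically embeds in $V$ if there is a smooth embedding $\varphi\colon U\hookrightarrow V$ with $\varphi^*\omega_0=\omega_0$. Let $n\ge 2$. (1) For all $a>2\pi$ and $\varepsilon>0$, the ellipsoid $E^{2n}(\pi,\dots,\pi,a)$ symplectically embeds in $B^{2n}\left(\frac a2+\pi+\varepsilon\right)$. (2) Consequently, the condition $a_n\le 2a_1$ cannot be weakened to $a_n\le\kappa a_1$ with any $\kappa>2$ in the theorem "if $0<a_1\le\dots\le a_n\le 2a_1$ and $0<A<a_n$, then $E^{2n}(a_1,\dots,a_n)$ does not symplectically embed in $B^{2n}(A)$". More precisely, for all $a_1>0$ and $a_n>2a_1$ there is a real number $A$ with $0<A<a_n$ such that $E^{2n}(a_1,\dots,a_1,a_n)$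 symplectically embeds in $B^{2n}(A)$. -/

import Mathlib

open scoped ContDiff

namespace SymplecticFolding

/-- The standard symplectic form `ω₀ = ∑ dxᵢ ∧ dyᵢ` on `ℂⁿ = ℝ²ⁿ`, with `zᵢ = xᵢ + i yᵢ`. -/
def omega {n : ℕ} (v w : Fin n → ℂ) : ℝ :=
  ∑ i, ((v i).re * (w i).im - (v i).im * (w i).re)

/-- The open symplectic ellipsoid `E(a₁, …, aₙ) = {z ∈ ℂⁿ | ∑ π |zᵢ|² / aᵢ < 1}`
(meaningful for positive `aᵢ`). -/
def ellipsoid {n : ℕ} (a : Fin n → ℝ) : Set (Fin n → ℂ) :=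
  {z | ∑ i, Real.pi * ‖z i‖ ^ 2 / a i < 1}

/-- The ellipsoid `E²ⁿ(b, …, b, c)`: all parameters are `b`, except the last one, which is `c`. -/
def ellipsoidLast (n : ℕ) (b c : ℝ) : Set (Fin n → ℂ) :=
  ellipsoid (fun i : Fin n => if (i : ℕ) + 1 = n then c else b)

/-- The ball `B²ⁿ(a) = E²ⁿ(a, …, a)`. -/
def ball (n : ℕ) (a : ℝ) : Set (Fin n → ℂ) :=
  ellipsoid (fun _ : Fin n => a)

/-- Ellipsoids are open, so that the derivative at their points is the usual one. -/
theorem isOpen_ellipsoid {n : ℕ} (a : Fin n → ℝ) : IsOpen (ellipsoid a) :=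
  isOpen_lt (by fun_prop) continuous_const

/-- `φ` restricts to a symplectic embedding of the open set `U` into `V`: a smooth map that is a
homeomorphism of `U` onto its image, lies in `V`, and satisfies `φ^* ω₀ = ω₀` on `U`.
(That `φ` is an immersion follows from the last condition, as `ω₀` is nondegenerate.) -/
structure IsSymplecticEmbedding {n : ℕ} (φ : (Fin n → ℂ) → (Fin n → ℂ))
    (U V : Set (Fin n → ℂ)) : Prop where
  isOpen_source : IsOpen U
  contDiffOn : ContDiffOn ℝ ∞ φ U
  isEmbedding : Topology.IsEmbedding (U.domRestrict φ)
  mapsTo : Set.MapsTo φ U V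
  pullback_omega : ∀ z ∈ U, ∀ v w : Fin n → ℂ,
    omega (fderiv ℝ φ z v) (fderiv ℝ φ z w) = omega v w

/-- `U` symplectically embeds in `V`. -/
def SymplecticallyEmbeds {n : ℕ} (U V : Set (Fin n → ℂ)) : Prop :=
  ∃ φ : (Fin n → ℂ) → (Fin n → ℂ), IsSymplecticEmbedding φ U V

end SymplecticFolding

/-! This is symplectic folding, applied to the first and last complex coordinates; the others stay
fixed. `exists_strip_coordinate` puts each of these two planes into a strip whose real part is
almost bounded by the action π|z|² and whose imaginary part, in (0, 1), plays the role of an angle.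
Write the ellipsoid as E(b, …, b, c). Over a base point with real part u in (0, c), its fibre in the
first factor then has length about b(1 - u/c), hence at most about b/2 once u ≥ c/2.

A Hamiltonian shear lifts the fibres over u < c/2 by b/2. It costs base area b/2 near the middle,
where the lift descends. The base is then folded back at its middle. The two halves may share the
same base, since there the lifted fibres lie above b/2 and the others below. Polar coordinates lead
back to ℂ. The total action is about u + b/2 + b(1 - u/c) before the fold; as b < c it is largest at
u = c/2, where it equals c/2 + b.

The angle matters only modulo 1. The fold is injective in |Im| < 1, so the only collisions to
exclude in `exists_fold_map` are between the two sides of the fold, at imaginary parts differing by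
exactly 1. `exists_fold_profile` supplies the required inequalities. Since c/2 + b < c exactly when
c > 2b, the second claim follows from the same embedding. -/

namespace SymplecticFolding

/-! ### Form-preserving maps and their products -/

/-- The area form `dx ∧ dy` on `ℂ`. -/
def areaForm (v w : ℂ) : ℝ := v.re * w.im - v.im * w.re

/-- The standard symplectic form on `ℂ × ℂ`. -/
def prodForm (v w : ℂ × ℂ) : ℝ := areaForm v.1 w.1 + areaForm v.2 w.2

/-- `f` is smooth at `z`, and its derivative at `z` preserves the form `Ω`. -/
structure PreservesAt {E : Type*} [NormedAddCommGroup E] [NormedSpace ℝ E] (Ω : E → E → ℝ)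
    (f : E → E) (z : E) : Prop where
  contDiffAt : ContDiffAt ℝ ∞ f z
  form_fderiv : ∀ v w, Ω (fderiv ℝ f z v) (fderiv ℝ f z w) = Ω v w

section

variable {E : Type*} [NormedAddCommGroup E] [NormedSpace ℝ E] {Ω : E → E → ℝ}

theorem PreservesAt.hasFDerivAt {f : E → E} {z : E} (h : PreservesAt Ω f z) :
    HasFDerivAt f (fderiv ℝ f z) z :=
  (h.contDiffAt.differentiableAt (by simp)).hasFDerivAt

theorem PreservesAt.of_hasFDerivAt {f : E → E} {z : E} (hf : ContDiffAt ℝ ∞ f z) {L : E →L[ℝ] E}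
    (hL : HasFDerivAt f L z) (h : ∀ v w, Ω (L v) (L w) = Ω v w) : PreservesAt Ω f z :=
  ⟨hf, by rw [hL.fderiv]; exact h⟩

theorem PreservesAt.comp {f g : E → E} {z : E} (hg : PreservesAt Ω g (f z))
    (hf : PreservesAt Ω f z) : PreservesAt Ω (fun x => g (f x)) z := by
  refine .of_hasFDerivAt (hg.contDiffAt.comp z hf.contDiffAt)
    (hg.hasFDerivAt.comp z hf.hasFDerivAt) fun v w => ?_
  simp [hg.form_fderiv, hf.form_fderiv]

end

/-- The derivative of a complex function given by its real and imaginary parts. -/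
theorem hasFDerivAt_mk {E : Type*} [NormedAddCommGroup E] [NormedSpace ℝ E] {a b : E → ℝ}
    {A B : E →L[ℝ] ℝ} {z : E} (hA : HasFDerivAt a A z) (hB : HasFDerivAt b B z) :
    HasFDerivAt (fun x => (⟨a x, b x⟩ : ℂ))
      ((Complex.equivRealProdCLM.symm : ℝ × ℝ →L[ℝ] ℂ).comp (A.prod B)) z :=
  (Complex.equivRealProdCLM.symm : ℝ × ℝ →L[ℝ] ℂ).hasFDerivAt.comp z (hA.prodMk hB)

theorem contDiffAt_mk {E : Type*} [NormedAddCommGroup E] [NormedSpace ℝ E] {a b : E → ℝ}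
    {z : E} (ha : ContDiffAt ℝ ∞ a z) (hb : ContDiffAt ℝ ∞ b z) :
    ContDiffAt ℝ ∞ (fun x => (⟨a x, b x⟩ : ℂ)) z :=
  (Complex.equivRealProdCLM.symm : ℝ × ℝ →L[ℝ] ℂ).contDiff.contDiffAt.comp z (ha.prodMk hb)

@[simp] theorem mk_clm_re {E : Type*} [NormedAddCommGroup E] [NormedSpace ℝ E]
    (A B : E →L[ℝ] ℝ) (v : E) :
    (((Complex.equivRealProdCLM.symm : ℝ × ℝ →L[ℝ] ℂ).comp (A.prod B)) v).re = A v := by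
  rfl

@[simp] theorem mk_clm_im {E : Type*} [NormedAddCommGroup E] [NormedSpace ℝ E]
    (A B : E →L[ℝ] ℝ) (v : E) :
    (((Complex.equivRealProdCLM.symm : ℝ × ℝ →L[ℝ] ℂ).comp (A.prod B)) v).im = B v := by
  rfl

theorem contDiff_re : ContDiff ℝ ∞ Complex.re := Complex.reCLM.contDiff
theorem contDiff_im : ContDiff ℝ ∞ Complex.im := Complex.imCLM.contDiff
theorem hasFDerivAt_re (z : ℂ) : HasFDerivAt Complex.re Complex.reCLM z :=
  Complex.reCLM.hasFDerivAt
theorem hasFDerivAt_im (z : ℂ) : HasFDerivAt Complex.im Complex.imCLM z :=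
  Complex.imCLM.hasFDerivAt

theorem preservesAt_mk {a b : ℂ → ℝ} {z : ℂ} (ha : ContDiffAt ℝ ∞ a z) (hb : ContDiffAt ℝ ∞ b z)
    {A B : ℂ →L[ℝ] ℝ} (hA : HasFDerivAt a A z) (hB : HasFDerivAt b B z)
    (h : ∀ v w : ℂ, A v * B w - B v * A w = v.re * w.im - v.im * w.re) :
    PreservesAt areaForm (fun x => (⟨a x, b x⟩ : ℂ)) z :=
  .of_hasFDerivAt (contDiffAt_mk ha hb) (hasFDerivAt_mk hA hB) fun v w => by
    simp only [areaForm, mk_clm_re, mk_clm_im]; exact h v w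

theorem PreservesAt.prodMap {f g : ℂ → ℂ} {z : ℂ × ℂ} (hf : PreservesAt areaForm f z.1)
    (hg : PreservesAt areaForm g z.2) :
    PreservesAt prodForm (fun x : ℂ × ℂ => (f x.1, g x.2)) z := by
  refine .of_hasFDerivAt ((hf.contDiffAt.comp z contDiffAt_fst).prodMk
    (hg.contDiffAt.comp z contDiffAt_snd))
    ((hf.hasFDerivAt.comp z hasFDerivAt_fst).prodMk (hg.hasFDerivAt.comp z hasFDerivAt_snd))
    fun v w => ?_
  simp [prodForm, hf.form_fderiv, hg.form_fderiv]

/-- An injective map with invertible derivative is an embedding. -/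
theorem isEmbedding_of_injective_fderiv {E : Type*} [NormedAddCommGroup E] [NormedSpace ℝ E]
    [FiniteDimensional ℝ E] {f : E → E} {U : Set E} (hU : IsOpen U)
    (hf : ∀ z ∈ U, ContDiffAt ℝ ∞ f z) (hinj : Set.InjOn f U)
    (hd : ∀ z ∈ U, Function.Injective (fderiv ℝ f z)) :
    Topology.IsOpenEmbedding (U.domRestrict f) := by
  have : CompleteSpace E := FiniteDimensional.complete ℝ E
  refine .of_continuous_injective_isOpenMap ?_ (Set.injOn_iff_injective.1 hinj) ?_
  · exact continuousOn_iff_continuous_domRestrict.1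
      fun z hz => (hf z hz).continuousAt.continuousWithinAt
  · rw [isOpenMap_iff_nhds_le]
    rintro ⟨z, hz⟩
    have hs := (hf z hz).hasStrictFDerivAt (by simp)
    have hr : ((fderiv ℝ f z : E →L[ℝ] E) : E →ₗ[ℝ] E).range = ⊤ :=
      LinearMap.range_eq_top.2 (LinearMap.injective_iff_surjective.1 (hd z hz))
    have h1 := hs.map_nhds_eq_of_surj hr
    have h2 : Filter.map (U.domRestrict f) (nhds (⟨z, hz⟩ : U)) = nhds (f z) := by
      rw [← h1, ← map_nhds_subtype_coe_eq_nhds hz (hU.mem_nhds hz)]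
      rfl
    exact h2.ge

theorem omega_injective {n : ℕ} {L : (Fin n → ℂ) →L[ℝ] (Fin n → ℂ)}
    (h : ∀ v w, omega (L v) (L w) = omega v w) : Function.Injective L := by
  rw [injective_iff_map_eq_zero]
  intro v hv
  have h0 : ∀ w, omega v w = 0 := fun w => by rw [← h, hv]; simp [omega]
  funext i
  have h1 := h0 (Pi.single i Complex.I)
  have h2 := h0 (Pi.single i 1)
  simp only [omega] at h1 h2
  rw [Finset.sum_eq_single i (fun j _ hj => by simp [Pi.single_eq_of_ne hj]) (by simp)] at h1 h2
  simp only [Pi.single_eq_same, Complex.I_re, Complex.I_im, Complex.one_re, Complex.one_im] at h1 h2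
  apply Complex.ext <;> simp <;> linarith

theorem isSymplecticEmbedding_of_preservesAt {n : ℕ} {f : (Fin n → ℂ) → Fin n → ℂ}
    {U V : Set (Fin n → ℂ)} (hU : IsOpen U) (hf : ∀ z ∈ U, PreservesAt omega f z)
    (hinj : Set.InjOn f U) (hm : Set.MapsTo f U V) : IsSymplecticEmbedding f U V where
  isOpen_source := hU
  contDiffOn z hz := (hf z hz).contDiffAt.contDiffWithinAt
  isEmbedding := (isEmbedding_of_injective_fderiv hU (fun z hz => (hf z hz).contDiffAt) hinj
    fun z hz => omega_injective (hf z hz).form_fderiv).isEmbedding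
  mapsTo := hm
  pullback_omega z hz := (hf z hz).form_fderiv

/-- Apply `Φ` to the coordinates `i` and `j`. -/
def liftPair {n : ℕ} (i j : Fin n) (Φ : ℂ × ℂ → ℂ × ℂ) (z : Fin n → ℂ) : Fin n → ℂ :=
  fun k => if k = i then (Φ (z i, z j)).1 else if k = j then (Φ (z i, z j)).2 else z k

theorem sum_eq_add_add {n : ℕ} {M : Type*} [AddCommMonoid M] {i j : Fin n} (hij : i ≠ j)
    (f : Fin n → M) :
    ∑ k, f k = f i + f j + ∑ k ∈ (Finset.univ.erase i).erase j, f k := by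
  rw [← Finset.add_sum_erase _ _ (Finset.mem_univ i),
    ← Finset.add_sum_erase _ _ (Finset.mem_erase.2 ⟨hij.symm, Finset.mem_univ j⟩), add_assoc]

theorem PreservesAt.liftPair {n : ℕ} {i j : Fin n} (hij : i ≠ j) {Φ : ℂ × ℂ → ℂ × ℂ}
    {z : Fin n → ℂ} (h : PreservesAt prodForm Φ (z i, z j)) :
    PreservesAt omega (liftPair i j Φ) z := by
  let pr : (Fin n → ℂ) →L[ℝ] ℂ × ℂ :=
    (ContinuousLinearMap.proj i).prod (ContinuousLinearMap.proj j)
  have hc : ContDiffAt ℝ ∞ (fun z => Φ (pr z)) z := h.contDiffAt.comp z pr.contDiff.contDiffAt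
  have hd : HasFDerivAt (fun z => Φ (pr z)) ((fderiv ℝ Φ (pr z)).comp pr) z :=
    h.hasFDerivAt.comp z pr.hasFDerivAt
  set D := fderiv ℝ Φ (pr z)
  let L : (Fin n → ℂ) →L[ℝ] (Fin n → ℂ) := ContinuousLinearMap.pi fun k =>
    if k = i then (ContinuousLinearMap.fst ℝ ℂ ℂ).comp (D.comp pr)
    else if k = j then (ContinuousLinearMap.snd ℝ ℂ ℂ).comp (D.comp pr)
    else ContinuousLinearMap.proj k
  refine .of_hasFDerivAt (L := L) ?_ ?_ fun v w => ?_
  · rw [contDiffAt_pi]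
    intro k
    unfold SymplecticFolding.liftPair
    split_ifs
    · exact contDiffAt_fst.comp z hc
    · exact contDiffAt_snd.comp z hc
    · exact contDiffAt_apply ..
  · rw [hasFDerivAt_pi]
    intro k
    unfold SymplecticFolding.liftPair
    split_ifs with h1 h2
    · exact hasFDerivAt_fst.comp z hd
    · exact hasFDerivAt_snd.comp z hd
    · exact hasFDerivAt_apply ..
  · have hD := h.form_fderiv (pr v) (pr w)
    change prodForm (D (pr v)) (D (pr w)) = _ at hD
    simp only [prodForm, areaForm] at hD
    rw [omega, omega, sum_eq_add_add hij, sum_eq_add_add hij]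
    congr 1
    · simp [L, hij.symm]
      exact hD
    · refine Finset.sum_congr rfl fun k hk => ?_
      simp only [Finset.mem_erase, Finset.mem_univ, and_true] at hk
      simp [L, hk.1, hk.2]

/-! ### From the plane to a strip -/

/-- The map (x, y) ↦ (X, Y) has the generating function xY - k(x)Q(Y). The maps (x, Y) ↦ (x, y) and
(x, Y) ↦ (X, Y) have the same Jacobian 1 - k'(x)Q'(Y), so composing the second with the inverse of
the first preserves area. -/
theorem exists_slit_coordinate {k Q : ℝ → ℝ} (hk : ContDiff ℝ ∞ k) (hQ : ContDiff ℝ ∞ Q)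
    (hpos : ∀ x y, 0 < 1 - deriv k x * deriv Q y)
    (hsurj : ∀ x, Function.Surjective fun y => y - deriv k x * Q y) :
    ∃ τ : ℂ → ℂ, (∀ z, PreservesAt areaForm τ z) ∧ Function.Injective τ ∧
      ∀ z, ∃ Y, z.im = Y - deriv k z.re * Q Y ∧ τ z = ⟨z.re - deriv Q Y * k z.re, Y⟩ := by
  have hk' : ContDiff ℝ ∞ (deriv k) := (contDiff_infty_iff_deriv.1 hk).2
  have hQ' : ContDiff ℝ ∞ (deriv Q) := (contDiff_infty_iff_deriv.1 hQ).2
  have dk : ∀ x, HasDerivAt k (deriv k x) x := fun x =>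
    (hk.differentiable (by simp) x).hasDerivAt
  have dQ : ∀ x, HasDerivAt Q (deriv Q x) x := fun x =>
    (hQ.differentiable (by simp) x).hasDerivAt
  have dk' : ∀ x, HasDerivAt (deriv k) (deriv (deriv k) x) x := fun x =>
    (hk'.differentiable (by simp) x).hasDerivAt
  have dQ' : ∀ x, HasDerivAt (deriv Q) (deriv (deriv Q) x) x := fun x =>
    (hQ'.differentiable (by simp) x).hasDerivAt
  have mono1 : ∀ x, StrictMono fun y => y - deriv k x * Q y := fun x =>
    strictMono_of_hasDerivAt_pos (f' := fun y => 1 - deriv k x * deriv Q y)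
      (fun y => (hasDerivAt_id y).sub ((dQ y).const_mul _)) fun y => hpos x y
  have mono2 : ∀ y, StrictMono fun x => x - deriv Q y * k x := fun y =>
    strictMono_of_hasDerivAt_pos (f' := fun x => 1 - deriv Q y * deriv k x)
      (fun x => (hasDerivAt_id x).sub ((dk x).const_mul _)) fun x => by
        have := hpos x y; linarith [mul_comm (deriv k x) (deriv Q y)]
  let A : ℂ → ℂ := fun p => ⟨p.re, p.im - deriv k p.re * Q p.im⟩
  let B : ℂ → ℂ := fun p => ⟨p.re - deriv Q p.im * k p.re, p.im⟩
  have hAc : ∀ p, ContDiffAt ℝ ∞ A p := fun p => contDiffAt_mk contDiff_re.contDiffAt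
    (contDiff_im.sub ((hk'.comp contDiff_re).mul (hQ.comp contDiff_im))).contDiffAt
  have hBc : ∀ p, ContDiffAt ℝ ∞ B p := fun p => contDiffAt_mk
    (contDiff_re.sub ((hQ'.comp contDiff_im).mul (hk.comp contDiff_re))).contDiffAt
    contDiff_im.contDiffAt
  have hAd : ∀ p v w, areaForm (fderiv ℝ A p v) (fderiv ℝ A p w) =
      (1 - deriv k p.re * deriv Q p.im) * areaForm v w := fun p v w => by
    have := hasFDerivAt_mk (hasFDerivAt_re p) ((hasFDerivAt_im p).sub
      (((dk' p.re).comp_hasFDerivAt p (hasFDerivAt_re p)).mul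
        ((dQ p.im).comp_hasFDerivAt p (hasFDerivAt_im p))))
    rw [HasFDerivAt.fderiv (f := A) this]
    simp only [areaForm, mk_clm_re, mk_clm_im]
    simp
    ring
  have hBd : ∀ p v w, areaForm (fderiv ℝ B p v) (fderiv ℝ B p w) =
      (1 - deriv k p.re * deriv Q p.im) * areaForm v w := fun p v w => by
    have := hasFDerivAt_mk ((hasFDerivAt_re p).sub
      (((dQ' p.im).comp_hasFDerivAt p (hasFDerivAt_im p)).mul
        ((dk p.re).comp_hasFDerivAt p (hasFDerivAt_re p)))) (hasFDerivAt_im p)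
    rw [HasFDerivAt.fderiv (f := B) this]
    simp only [areaForm, mk_clm_re, mk_clm_im]
    simp
    ring
  have hAinj : Function.Injective A := fun p p' h => by
    have h1 : p.re = p'.re := (Complex.ext_iff.1 h).1
    have h2 : p.im - deriv k p.re * Q p.im = p'.im - deriv k p'.re * Q p'.im :=
      (Complex.ext_iff.1 h).2
    rw [← h1] at h2
    exact Complex.ext h1 ((mono1 p.re).injective h2)
  have hAsurj : Function.Surjective A := fun z => by
    obtain ⟨Y, hY⟩ := hsurj z.re z.im
    exact ⟨⟨z.re, Y⟩, Complex.ext rfl hY⟩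
  obtain ⟨G, hG⟩ := hAsurj.hasRightInverse
  -- By injectivity of `A`, the set-theoretic inverse agrees near each point with the local inverse
  -- of the inverse function theorem, hence is smooth.
  have hGc : ∀ z, ContDiffAt ℝ ∞ G z := fun z => by
    have hinj : Function.Injective (fderiv ℝ A (G z)) := by
      rw [injective_iff_map_eq_zero]
      intro v hv
      have h0 : ∀ w, areaForm v w = 0 := fun w => by
        have := hAd (G z) v w
        rw [hv] at this
        have h1 : areaForm 0 (fderiv ℝ A (G z) w) = 0 := by simp [areaForm]
        rw [h1] at this
        exact (mul_eq_zero.1 this.symm).resolve_left (hpos _ _).ne'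
      have h1 := h0 Complex.I
      have h2 := h0 1
      simp [areaForm] at h1 h2
      exact Complex.ext h1 h2
    let e : ℂ ≃L[ℝ] ℂ := (LinearEquiv.ofInjectiveEndo _ hinj).toContinuousLinearEquiv
    have he : HasFDerivAt A (e : ℂ →L[ℝ] ℂ) (G z) :=
      ((hAc (G z)).differentiableAt (by simp)).hasFDerivAt
    have hloc := (hAc (G z)).to_localInverse he (by simp)
    have hs := (hAc (G z)).hasStrictFDerivAt' he (by simp)
    have hev := hs.eventually_right_inverse
    rw [hG z] at hloc hev
    exact hloc.congr_of_eventuallyEq (hev.mono fun y hy => hAinj ((hG y).trans hy.symm))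
  have hGd : ∀ z, HasFDerivAt G (fderiv ℝ G z) z := fun z =>
    ((hGc z).differentiableAt (by simp)).hasFDerivAt
  have hchain : ∀ z v, fderiv ℝ A (G z) (fderiv ℝ G z v) = v := fun z v => by
    have h1 := (((hAc (G z)).differentiableAt (by simp)).hasFDerivAt).comp z (hGd z)
    have h2 : A ∘ G = id := funext hG
    rw [h2] at h1
    simpa using congrArg (fun L : ℂ →L[ℝ] ℂ => L v) (h1.unique (hasFDerivAt_id z))
  refine ⟨fun z => B (G z), fun z => ?_, fun z z' h => ?_, fun z => ?_⟩
  · refine .of_hasFDerivAt ((hBc _).comp z (hGc z))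
      ((((hBc (G z)).differentiableAt (by simp)).hasFDerivAt).comp z (hGd z)) fun v w => ?_
    simp only [ContinuousLinearMap.comp_apply]
    rw [hBd, ← hAd, hchain, hchain]
  · have h1 : (G z).re - deriv Q (G z).im * k (G z).re =
      (G z').re - deriv Q (G z').im * k (G z').re := (Complex.ext_iff.1 h).1
    have h2 : (G z).im = (G z').im := (Complex.ext_iff.1 h).2
    rw [← h2] at h1
    have h3 : G z = G z' := Complex.ext ((mono2 _).injective h1) h2
    rw [← hG z, ← hG z', h3]
  · have h1 : (G z).re = z.re := (Complex.ext_iff.1 (hG z)).1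
    have h2 : (G z).im - deriv k (G z).re * Q (G z).im = z.im := (Complex.ext_iff.1 (hG z)).2
    rw [h1] at h2
    exact ⟨(G z).im, h2.symm, by simp [B, h1]⟩

/-- An area preserving embedding of the plane into the complement of the ray `[0, ∞)` which hardly
increases the norm. -/
theorem exists_slit_embedding {d : ℝ} (hd : 0 < d) :
    ∃ τ : ℂ → ℂ, (∀ z, PreservesAt areaForm τ z) ∧ Function.Injective τ ∧
      ∀ z, -τ z ∈ Complex.slitPlane ∧ |(τ z).re| ≤ |z.re| + d ∧ |(τ z).im| ≤ |z.im| + 2 * d := by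
  have hsq : ∀ x : ℝ, 0 < x ^ 2 + d ^ 2 := fun x => by positivity
  have habs : ∀ x : ℝ, |x| < √(x ^ 2 + d ^ 2) := fun x => by
    rw [← Real.sqrt_sq_eq_abs]
    exact Real.sqrt_lt_sqrt (sq_nonneg x) (by linarith [sq_pos_of_pos hd])
  have hle : ∀ x : ℝ, √(x ^ 2 + d ^ 2) ≤ |x| + d := fun x => by
    rw [Real.sqrt_le_left (by positivity)]
    nlinarith [sq_abs x, abs_nonneg x]
  -- `k` is a smooth majorant of the positive part of x, and `Q` is bounded by a multiple of d with
  -- `deriv Q 0 = 1`. On Y = 0 the new real part is x - k(x) < 0, which keeps the image off the ray.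
  let k : ℝ → ℝ := fun x => (x + √(x ^ 2 + d ^ 2)) / 2
  let Q : ℝ → ℝ := fun y => d * Real.arctan (y / d)
  have hk : ContDiff ℝ ∞ k :=
    (contDiff_id.add (ContDiff.sqrt (by fun_prop) fun x => (hsq x).ne')).div_const 2
  have hQ : ContDiff ℝ ∞ Q :=
    contDiff_const.mul (Real.contDiff_arctan.comp (contDiff_id.div_const d))
  have dk : ∀ x, deriv k x = (1 + x / √(x ^ 2 + d ^ 2)) / 2 := fun x => by
    have h1 : HasDerivAt (fun x : ℝ => x ^ 2 + d ^ 2) (2 * x) x := by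
      simpa using (hasDerivAt_pow 2 x).add_const (d ^ 2)
    have h2 := ((hasDerivAt_id x).add (h1.sqrt (hsq x).ne')).div_const 2
    rw [HasDerivAt.deriv (f := k) h2]
    congr 2
    rw [mul_div_mul_left _ _ two_ne_zero]
  have dQ : ∀ y, deriv Q y = 1 / (1 + (y / d) ^ 2) := fun y => by
    have h2 := (((hasDerivAt_id y).div_const d).arctan).const_mul d
    rw [HasDerivAt.deriv (f := Q) h2]
    simp only [id]
    field_simp
  have hk0 : ∀ x, 0 < deriv k x := fun x => by
    rw [dk]
    have := (abs_lt.1 (habs x)).1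
    have h3 : -1 < x / √(x ^ 2 + d ^ 2) := by
      rw [lt_div_iff₀ (Real.sqrt_pos.2 (hsq x))]; linarith
    linarith
  have hk1 : ∀ x, deriv k x < 1 := fun x => by
    rw [dk]
    have := (abs_lt.1 (habs x)).2
    have h3 : x / √(x ^ 2 + d ^ 2) < 1 := by
      rw [div_lt_one (Real.sqrt_pos.2 (hsq x))]; exact this
    linarith
  have hq0 : ∀ y, 0 < deriv Q y := fun y => by rw [dQ]; positivity
  have hq1 : ∀ y, deriv Q y ≤ 1 := fun y => by
    rw [dQ, div_le_one (by positivity)]; nlinarith [sq_nonneg (y / d)]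
  have hQb : ∀ y, |Q y| ≤ 2 * d := fun y => by
    simp only [Q]
    rw [abs_mul, abs_of_pos hd, mul_comm]
    refine mul_le_mul_of_nonneg_right ?_ hd.le
    rw [abs_le]
    have := Real.pi_lt_four
    exact ⟨by linarith [Real.neg_pi_div_two_lt_arctan (y / d)],
      by linarith [Real.arctan_lt_pi_div_two (y / d)]⟩
  have hkpos : ∀ x, 0 < k x := fun x => by
    have := (abs_lt.1 (habs x)).1
    simp only [k]; linarith
  have hkQ : ∀ x y, |deriv k x * Q y| ≤ 2 * d := fun x y => by
    rw [abs_mul, abs_of_pos (hk0 x)]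
    nlinarith [hQb y, hk1 x, hk0 x, abs_nonneg (Q y)]
  obtain ⟨τ, h1, h2, h3⟩ := exists_slit_coordinate hk hQ (fun x y => by
      nlinarith [hk0 x, hk1 x, hq0 y, hq1 y]) (fun x => by
      refine Continuous.surjective (by fun_prop) ?_ ?_
      · refine Filter.tendsto_atTop_mono (f := fun y => y - 2 * d)
          (fun y => by have := (abs_le.1 (hkQ x y)).2; linarith)
          (Filter.tendsto_atTop_add_const_right _ _ Filter.tendsto_id)
      · refine Filter.tendsto_atBot_mono (g := fun y => y - deriv k x * Q y)
          (f := fun y => y + 2 * d)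
          (fun y => by have := (abs_le.1 (hkQ x y)).1; linarith)
          (Filter.tendsto_atBot_add_const_right _ _ Filter.tendsto_id))
  refine ⟨τ, h1, h2, fun z => ?_⟩
  obtain ⟨Y, hY, hz⟩ := h3 z
  rw [hz]
  refine ⟨?_, ?_, ?_⟩
  · rw [Complex.mem_slitPlane_iff]
    by_cases hY0 : Y = 0
    · left
      have : deriv Q Y = 1 := by rw [dQ, hY0]; simp
      have h4 := (abs_lt.1 (habs z.re)).2
      simp only [Complex.neg_re, this, k]
      linarith
    · right; simpa using hY0
  · have e1 := mul_pos (hq0 Y) (hkpos z.re)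
    have e2 : deriv Q Y * k z.re ≤ k z.re := by nlinarith [hq1 Y, hkpos z.re]
    have e3 : k z.re ≤ (z.re + |z.re| + d) / 2 := by
      simp only [k]; linarith [hle z.re]
    rw [abs_le]
    rcases abs_cases z.re with ⟨h, _⟩ | ⟨h, _⟩ <;> rw [h] at e3 ⊢ <;> constructor <;> linarith
  · have := hkQ z.re Y
    have e : Y = z.im + deriv k z.re * Q Y := by linarith
    calc |Y| = |z.im + deriv k z.re * Q Y| := by rw [← e]
      _ ≤ _ := (abs_add_le _ _).trans (by linarith)

/-- Symplectic polar coordinates `(π r², θ / 2π)` on the complement of the ray `[0, ∞)`. -/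
noncomputable def toPolar (w : ℂ) : ℂ :=
  ⟨Real.pi * (w.re ^ 2 + w.im ^ 2), (Complex.log (-w)).im / (2 * Real.pi) + 1 / 2⟩

/-- The inverse of symplectic polar coordinates. -/
noncomputable def ofPolar (p : ℂ) : ℂ :=
  (√(p.re / Real.pi) : ℂ) * Complex.exp (2 * Real.pi * p.im * Complex.I)

theorem preservesAt_toPolar {w : ℂ} (hw : -w ∈ Complex.slitPlane) :
    PreservesAt areaForm toPolar w := by
  have hw0 : w ≠ 0 := fun h => by simp [h] at hw
  have hn : w.re ^ 2 + w.im ^ 2 ≠ 0 := by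
    have := Complex.normSq_pos.2 hw0
    rw [Complex.normSq_apply] at this
    nlinarith
  have hlogc : ContDiffAt ℝ ∞ (fun w => Complex.log (-w)) w :=
    ((Complex.contDiffAt_log hw).restrict_scalars ℝ).comp w contDiff_neg.contDiffAt
  have hlogd := (Complex.hasStrictFDerivAt_log_real hw).hasFDerivAt.comp w
    (hasFDerivAt_id w).neg
  have him := (hasFDerivAt_im _).comp w hlogd
  refine preservesAt_mk (contDiff_const.mul
    ((contDiff_re.pow 2).add (contDiff_im.pow 2))).contDiffAt
    (((contDiff_im.contDiffAt.comp w hlogc).div_const _).add contDiffAt_const)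
    ((((hasFDerivAt_re w).pow 2).add ((hasFDerivAt_im w).pow 2)).const_mul Real.pi)
    ((him.mul_const (2 * Real.pi)⁻¹).add_const (1 / 2)) fun v u => ?_
  have hpi := Real.pi_ne_zero
  simp [Complex.normSq_apply]
  simp only [← sq]
  field_simp
  ring

theorem toPolar_im_mem {w : ℂ} (hw : -w ∈ Complex.slitPlane) :
    0 < (toPolar w).im ∧ (toPolar w).im < 1 := by
  have hpi := Real.pi_pos
  have h1 : -Real.pi < (Complex.log (-w)).im := Complex.neg_pi_lt_log_im _
  have h2 : (Complex.log (-w)).im < Real.pi := by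
    rw [Complex.log_im]
    exact lt_of_le_of_ne (Complex.arg_le_pi _) (Complex.mem_slitPlane_iff_arg.1 hw).1
  simp only [toPolar]
  have e : (Complex.log (-w)).im / (2 * Real.pi) * (2 * Real.pi) = (Complex.log (-w)).im :=
    div_mul_cancel₀ _ (by positivity)
  constructor <;> nlinarith

theorem ofPolar_toPolar {w : ℂ} (hw : -w ∈ Complex.slitPlane) : ofPolar (toPolar w) = w := by
  have hpi := Real.pi_ne_zero
  have hw0 : -w ≠ 0 := Complex.slitPlane_ne_zero hw
  simp only [ofPolar, toPolar]
  have h1 : √(Real.pi * (w.re ^ 2 + w.im ^ 2) / Real.pi) = ‖-w‖ := by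
    rw [mul_div_cancel_left₀ _ hpi, norm_neg, Complex.norm_def, Complex.normSq_apply]
    congr 1; ring
  have h2 : 2 * (Real.pi : ℂ) *
      (((Complex.log (-w)).im / (2 * Real.pi) + 1 / 2 : ℝ) : ℂ) * Complex.I =
      (Complex.arg (-w)) * Complex.I + Real.pi * Complex.I := by
    rw [Complex.log_im]
    have : (Real.pi : ℂ) ≠ 0 := by exact_mod_cast hpi
    push_cast
    field_simp
  rw [h1, h2, Complex.exp_add, Complex.exp_pi_mul_I, ← mul_assoc,
    Complex.norm_mul_exp_arg_mul_I]
  ring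

theorem preservesAt_ofPolar {p : ℂ} (hp : 0 < p.re) : PreservesAt areaForm ofPolar p := by
  have hpi := Real.pi_pos
  have hq : 0 < p.re / Real.pi := by positivity
  let c : ℂ → ℝ := fun p => √(p.re / Real.pi) * Real.cos (2 * Real.pi * p.im)
  let s : ℂ → ℝ := fun p => √(p.re / Real.pi) * Real.sin (2 * Real.pi * p.im)
  have hfun : ofPolar = fun p => (⟨c p, s p⟩ : ℂ) := by
    funext p
    have : 2 * (Real.pi : ℂ) * p.im * Complex.I = ((2 * Real.pi * p.im : ℝ) : ℂ) * Complex.I := by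
      push_cast; ring
    rw [ofPolar, this]
    apply Complex.ext
    · rw [Complex.re_ofReal_mul, Complex.exp_ofReal_mul_I_re]
    · rw [Complex.im_ofReal_mul, Complex.exp_ofReal_mul_I_im]
  rw [hfun]
  have h1 : ContDiffAt ℝ ∞ (fun p : ℂ => √(p.re / Real.pi)) p :=
    (contDiff_re.contDiffAt.div_const _).sqrt hq.ne'
  have h2 : ContDiffAt ℝ ∞ (fun p : ℂ => 2 * Real.pi * p.im) p :=
    (contDiff_const.mul contDiff_im).contDiffAt
  have d1 := ((hasFDerivAt_re p).mul_const Real.pi⁻¹).sqrt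
    (by rw [← div_eq_mul_inv]; exact hq.ne')
  have d2 := (hasFDerivAt_im p).const_mul (2 * Real.pi)
  refine preservesAt_mk (h1.mul h2.cos) (h1.mul h2.sin) (d1.mul d2.cos) (d1.mul d2.sin)
    fun v w => ?_
  have hr := Real.sqrt_pos.2 hq
  have hcs := Real.sin_sq_add_cos_sq (2 * Real.pi * p.im)
  simp only [← div_eq_mul_inv]
  set C := Real.cos (2 * Real.pi * p.im)
  set S := Real.sin (2 * Real.pi * p.im)
  set ρ := √(p.re / Real.pi)
  simp
  field_simp
  linear_combination 4 * ρ ^ 2 * Real.pi ^ 2 * (v.re * w.im - v.im * w.re) * hcs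

theorem norm_ofPolar {p : ℂ} (hp : 0 ≤ p.re) : Real.pi * ‖ofPolar p‖ ^ 2 = p.re := by
  have hpi := Real.pi_pos
  have : 2 * (Real.pi : ℂ) * p.im * Complex.I = ((2 * Real.pi * p.im : ℝ) : ℂ) * Complex.I := by
    push_cast; ring
  rw [ofPolar, this, norm_mul, Complex.norm_exp_ofReal_mul_I, mul_one, Complex.norm_real,
    Real.norm_eq_abs, sq_abs, Real.sq_sqrt (by positivity)]
  field_simp

/-- The modulus determines the action, and the period of the exponential leaves an integer ambiguity
in the normalised angle. -/
theorem ofPolar_eq_iff {p p' : ℂ} (hp : 0 < p.re) (hp' : 0 < p'.re)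
    (h : ofPolar p = ofPolar p') : p.re = p'.re ∧ ∃ m : ℤ, p.im = p'.im + m := by
  have hre : p.re = p'.re := by rw [← norm_ofPolar hp.le, h, norm_ofPolar hp'.le]
  refine ⟨hre, ?_⟩
  have hpi := Real.pi_pos
  simp only [ofPolar, hre] at h
  have hs : ((√(p'.re / Real.pi) : ℝ) : ℂ) ≠ 0 := by
    exact_mod_cast (Real.sqrt_pos.2 (div_pos hp' hpi)).ne'
  obtain ⟨m, hm⟩ := Complex.exp_eq_exp_iff_exists_int.1 (mul_left_cancel₀ hs h)
  refine ⟨m, ?_⟩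
  have h1 : 2 * (Real.pi : ℂ) * Complex.I * p.im = 2 * Real.pi * Complex.I * (p'.im + m) := by
    linear_combination hm
  have h2 := mul_left_cancel₀ (by simp [hpi.ne']) h1
  exact_mod_cast h2

/-- Area preserving coordinates on the plane with values in the strip `(0, ∞) × (0, 1)`, whose first
coordinate is almost bounded by `π |z|²`. -/
theorem exists_strip_coordinate {R e : ℝ} (hR : 0 ≤ R) (he : 0 < e) :
    ∃ P : ℂ → ℂ, (∀ z, PreservesAt areaForm P z) ∧ Function.Injective P ∧
      ∀ z, 0 < (P z).re ∧ 0 < (P z).im ∧ (P z).im < 1 ∧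
        (‖z‖ ≤ R → (P z).re ≤ Real.pi * ‖z‖ ^ 2 + e) := by
  have hpi := Real.pi_pos
  -- For |x|, |y| ≤ R and d ≤ 1, (|x| + d)² + (|y| + 2d)² exceeds x² + y² by at most 6Rd + 5d² ≤ (6R
  -- + 5)d.
  obtain ⟨d, hd, hd1, hde⟩ : ∃ d : ℝ, 0 < d ∧ d ≤ 1 ∧ Real.pi * (6 * R + 5) * d ≤ e := by
    refine ⟨min 1 (e / (Real.pi * (6 * R + 5))), by positivity, min_le_left _ _, ?_⟩
    rw [← le_div_iff₀' (by positivity)]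
    exact min_le_right _ _
  obtain ⟨τ, h1, h2, h3⟩ := exists_slit_embedding hd
  refine ⟨fun z => toPolar (τ z), fun z => (preservesAt_toPolar (h3 z).1).comp (h1 z),
    fun z z' h => h2 ?_, fun z => ⟨?_, (toPolar_im_mem (h3 z).1).1, (toPolar_im_mem (h3 z).1).2,
      fun hz => ?_⟩⟩
  · rw [← ofPolar_toPolar (h3 z).1, ← ofPolar_toPolar (h3 z').1]
    exact congrArg ofPolar h
  · have hw0 : τ z ≠ 0 := neg_ne_zero.1 (Complex.slitPlane_ne_zero (h3 z).1)
    have := Complex.normSq_pos.2 hw0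
    rw [Complex.normSq_apply, ← sq, ← sq] at this
    exact mul_pos hpi this
  · obtain ⟨-, hx, hy⟩ := h3 z
    have ex : |z.re| ≤ R := (Complex.abs_re_le_norm z).trans hz
    have ey : |z.im| ≤ R := (Complex.abs_im_le_norm z).trans hz
    have hn : ‖z‖ ^ 2 = |z.re| ^ 2 + |z.im| ^ 2 := by
      rw [Complex.sq_norm, Complex.normSq_apply, sq_abs, sq_abs]; ring
    have e1 : (τ z).re ^ 2 ≤ (|z.re| + d) ^ 2 := by
      rw [← sq_abs]; exact pow_le_pow_left₀ (abs_nonneg _) hx 2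
    have e2 : (τ z).im ^ 2 ≤ (|z.im| + 2 * d) ^ 2 := by
      rw [← sq_abs]; exact pow_le_pow_left₀ (abs_nonneg _) hy 2
    have e3 : (τ z).re ^ 2 + (τ z).im ^ 2 ≤ ‖z‖ ^ 2 + (6 * R + 5) * d := by
      rw [hn]
      nlinarith [mul_nonneg hd.le (sub_nonneg.2 ex), mul_nonneg hd.le (sub_nonneg.2 ey),
        mul_nonneg hd.le (sub_nonneg.2 hd1)]
    simp only [toPolar]
    calc _ ≤ Real.pi * (‖z‖ ^ 2 + (6 * R + 5) * d) := mul_le_mul_of_nonneg_left e3 hpi.le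
      _ ≤ _ := by linarith

/-! ### Folding a half-plane and a strip -/

/-- The area preserving double cover `z ↦ z² / |z|`, with the imaginary part halved. -/
noncomputable def halfPlaneFold (p : ℂ) : ℂ :=
  ⟨(p.re ^ 2 - p.im ^ 2) / √(p.re ^ 2 + p.im ^ 2), p.re * p.im / √(p.re ^ 2 + p.im ^ 2)⟩

section

variable {p : ℂ}

theorem preservesAt_halfPlaneFold (hp : 0 < p.im) : PreservesAt areaForm halfPlaneFold p := by
  have hs : 0 < p.re ^ 2 + p.im ^ 2 := by positivity
  have hr := Real.sqrt_pos.2 hs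
  have hc : ContDiffAt ℝ ∞ (fun p : ℂ => √(p.re ^ 2 + p.im ^ 2)) p :=
    ((contDiff_re.pow 2).add (contDiff_im.pow 2)).contDiffAt.sqrt hs.ne'
  have hd := (((hasFDerivAt_re p).pow 2).add ((hasFDerivAt_im p).pow 2)).sqrt hs.ne'
  have hi := (hasDerivAt_inv hr.ne').comp_hasFDerivAt p hd
  refine preservesAt_mk
    (((contDiff_re.pow 2).sub (contDiff_im.pow 2)).contDiffAt.div hc hr.ne')
    ((contDiff_re.mul contDiff_im).contDiffAt.div hc hr.ne')
    ((((hasFDerivAt_re p).pow 2).sub ((hasFDerivAt_im p).pow 2)).mul hi)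
    (((hasFDerivAt_re p).mul (hasFDerivAt_im p)).mul hi) fun v w => ?_
  have hsq := Real.sq_sqrt hs.le
  simp only [Pi.add_apply] at *
  set r := √(p.re ^ 2 + p.im ^ 2)
  simp
  field_simp
  simp only [show r ^ 6 = (r ^ 2) ^ 3 by ring, hsq]
  ring

theorem re_halfPlaneFold_le_abs : (halfPlaneFold p).re ≤ |p.re| := by
  have hr : |p.re| ≤ √(p.re ^ 2 + p.im ^ 2) := by
    rw [← Real.sqrt_sq_eq_abs]
    exact Real.sqrt_le_sqrt (by nlinarith [sq_nonneg p.im])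
  refine div_le_of_le_mul₀ (Real.sqrt_nonneg _) (abs_nonneg _) ?_
  nlinarith [sq_abs p.re, abs_nonneg p.re, sq_nonneg p.im]

theorem le_re_halfPlaneFold (hp : 0 < p.im) : |p.re| - 2 * p.im ≤ (halfPlaneFold p).re := by
  have hs : 0 < p.re ^ 2 + p.im ^ 2 := by positivity
  have hsq := Real.sq_sqrt hs.le
  have hr0 := Real.sqrt_pos.2 hs
  have hx := abs_nonneg p.re
  have hx2 := sq_abs p.re
  simp only [halfPlaneFold]
  rw [le_div_iff₀ hr0]
  set r := √(p.re ^ 2 + p.im ^ 2)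
  have hr1 : r ≤ |p.re| + p.im := by nlinarith
  have hr2 : p.im ≤ r := by nlinarith [sq_nonneg p.re]
  rcases le_total (2 * p.im) |p.re| with h | h <;> nlinarith

theorem abs_im_halfPlaneFold_lt (hp : 0 < p.im) : |(halfPlaneFold p).im| < p.im := by
  have hs : 0 < p.re ^ 2 + p.im ^ 2 := by positivity
  have hr0 := Real.sqrt_pos.2 hs
  have hr : |p.re| < √(p.re ^ 2 + p.im ^ 2) := by
    rw [← Real.sqrt_sq_eq_abs]
    exact Real.sqrt_lt_sqrt (sq_nonneg _) (by nlinarith)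
  simp only [halfPlaneFold]
  rw [abs_div, abs_mul, abs_of_pos hp, abs_of_pos hr0, div_lt_iff₀ hr0, mul_comm]
  exact mul_lt_mul_of_pos_left hr hp

theorem im_halfPlaneFold_pos_iff (hp : 0 < p.im) : 0 < (halfPlaneFold p).im ↔ 0 < p.re := by
  have hs : 0 < p.re ^ 2 + p.im ^ 2 := by positivity
  simp only [halfPlaneFold]
  rw [div_pos_iff_of_pos_right (Real.sqrt_pos.2 hs), mul_pos_iff_of_pos_right hp]

theorem im_halfPlaneFold_neg_iff (hp : 0 < p.im) : (halfPlaneFold p).im < 0 ↔ p.re < 0 := by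
  have hs : 0 < p.re ^ 2 + p.im ^ 2 := by positivity
  simp only [halfPlaneFold]
  rw [← neg_pos, ← neg_div, ← neg_mul, div_pos_iff_of_pos_right (Real.sqrt_pos.2 hs),
    mul_pos_iff_of_pos_right hp, neg_pos]

/-- With image X + iY one has X² + 4Y² = |p|², so the image determines |p|. Then X determines (Im
p)², and positivity of Im p leaves a single preimage. -/
theorem halfPlaneFold_injOn : Set.InjOn halfPlaneFold {p | 0 < p.im} := by
  have key : ∀ p : ℂ, 0 < p.im → √(p.re ^ 2 + p.im ^ 2) ^ 2 =
      (halfPlaneFold p).re ^ 2 + 4 * (halfPlaneFold p).im ^ 2 := fun p hp => by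
    have hs : 0 < p.re ^ 2 + p.im ^ 2 := by positivity
    have hr := Real.sqrt_pos.2 hs
    have hsq := Real.sq_sqrt hs.le
    simp only [halfPlaneFold]
    set r := √(p.re ^ 2 + p.im ^ 2)
    field_simp
    rw [show r ^ 4 = (r ^ 2) ^ 2 by ring, hsq]
    ring
  intro p hp p' hp' h
  simp only [Set.mem_ofPred_eq] at hp hp'
  have hs : 0 < p.re ^ 2 + p.im ^ 2 := by positivity
  have hs' : 0 < p'.re ^ 2 + p'.im ^ 2 := by positivity
  have h1 : √(p.re ^ 2 + p.im ^ 2) = √(p'.re ^ 2 + p'.im ^ 2) := by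
    rw [← sq_eq_sq₀ (Real.sqrt_nonneg _) (Real.sqrt_nonneg _), key p hp, key p' hp', h]
  have h2 : p.re ^ 2 + p.im ^ 2 = p'.re ^ 2 + p'.im ^ 2 := by
    rw [← Real.sq_sqrt hs.le, h1, Real.sq_sqrt hs'.le]
  have hr := Real.sqrt_pos.2 hs
  obtain ⟨h3, h4⟩ := Complex.ext_iff.1 h
  simp only [halfPlaneFold] at h3 h4
  rw [← h1, div_left_inj' hr.ne'] at h3 h4
  have h5 : p.im = p'.im := by
    rw [← sq_eq_sq₀ hp.le hp'.le]; linarith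
  rw [← h5] at h4
  exact Complex.ext (mul_right_cancel₀ hp.ne' h4) h5

end

/-- The fold of the strip at the line `Re = t`. -/
noncomputable def stripFold (t L : ℝ) (p : ℂ) : ℂ :=
  ⟨t - (halfPlaneFold ⟨L * (p.re - t), p.im / L⟩).re / L,
    -(L * (halfPlaneFold ⟨L * (p.re - t), p.im / L⟩).im)⟩

section

variable {t L : ℝ} {p : ℂ}

theorem preservesAt_stripFold (hL : 0 < L) (hp : 0 < p.im) :
    PreservesAt areaForm (stripFold t L) p := by
  have h1 : PreservesAt areaForm (fun p : ℂ => (⟨L * (p.re - t), p.im / L⟩ : ℂ)) p := by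
    refine preservesAt_mk (contDiff_const.mul (contDiff_re.sub contDiff_const)).contDiffAt
      (contDiff_im.div_const L).contDiffAt (((hasFDerivAt_re p).sub_const t).const_mul L)
      ((hasFDerivAt_im p).mul_const L⁻¹) fun v w => ?_
    simp
    field_simp
  have h3 : ∀ p, PreservesAt areaForm (fun p : ℂ => (⟨t - p.re / L, -(L * p.im)⟩ : ℂ)) p := by
    intro p
    refine preservesAt_mk (contDiff_const.sub (contDiff_re.div_const L)).contDiffAt
      (contDiff_const.mul contDiff_im).neg.contDiffAt
      (((hasFDerivAt_re p).mul_const L⁻¹).const_sub t)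
      ((hasFDerivAt_im p).const_mul L).neg fun v w => ?_
    simp
    field_simp
  exact (h3 _).comp ((preservesAt_halfPlaneFold (by simpa using div_pos hp hL)).comp h1)

theorem le_re_stripFold (hL : 0 < L) : t - |p.re - t| ≤ (stripFold t L p).re := by
  have := re_halfPlaneFold_le_abs (p := ⟨L * (p.re - t), p.im / L⟩)
  simp only [abs_mul, abs_of_pos hL] at this
  rw [← div_le_iff₀' hL] at this
  simp only [stripFold]
  linarith

/-- Stretching by L before folding and shrinking afterwards turns the error 2 Im of the half-plane
fold into 2 Im / L², so the fold approximates the reflection of the real part at t. -/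
theorem re_stripFold_le (hL : 0 < L) (hp : 0 < p.im) :
    (stripFold t L p).re ≤ t - |p.re - t| + 2 / L ^ 2 * p.im := by
  have := le_re_halfPlaneFold (p := ⟨L * (p.re - t), p.im / L⟩) (div_pos hp hL)
  simp only [abs_mul, abs_of_pos hL] at this
  have h2 := div_le_div_of_nonneg_right this hL.le
  have h3 : (L * |p.re - t| - 2 * (p.im / L)) / L = |p.re - t| - 2 / L ^ 2 * p.im := by
    field_simp
  simp only [stripFold]
  linarith

theorem abs_im_stripFold_lt (hL : 0 < L) (hp : 0 < p.im) : |(stripFold t L p).im| < p.im := by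
  have := abs_im_halfPlaneFold_lt (p := ⟨L * (p.re - t), p.im / L⟩) (div_pos hp hL)
  simp only at this
  simp only [stripFold]
  rwa [abs_neg, abs_mul, abs_of_pos hL, ← lt_div_iff₀' hL]

theorem im_stripFold_neg_iff (hL : 0 < L) (hp : 0 < p.im) :
    (stripFold t L p).im < 0 ↔ t < p.re := by
  simp only [stripFold]
  rw [neg_lt_zero, mul_pos_iff_of_pos_left hL, im_halfPlaneFold_pos_iff (div_pos hp hL),
    mul_pos_iff_of_pos_left hL, sub_pos]

theorem im_stripFold_pos_iff (hL : 0 < L) (hp : 0 < p.im) :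
    0 < (stripFold t L p).im ↔ p.re < t := by
  simp only [stripFold]
  rw [← mul_neg, mul_pos_iff_of_pos_left hL, neg_pos, im_halfPlaneFold_neg_iff (div_pos hp hL),
    ← neg_pos, ← mul_neg, mul_pos_iff_of_pos_left hL, neg_sub, sub_pos]

theorem stripFold_injOn (hL : 0 < L) : Set.InjOn (stripFold t L) {p | 0 < p.im} := by
  intro p hp p' hp' h
  obtain ⟨h1, h2⟩ := Complex.ext_iff.1 h
  simp only [stripFold] at h1 h2
  have h3 := halfPlaneFold_injOn (Set.mem_ofPred_eq ▸ div_pos hp hL) (Set.mem_ofPred_eq ▸ div_pos hp' hL)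
    (Complex.ext (z := halfPlaneFold ⟨L * (p.re - t), p.im / L⟩)
      (w := halfPlaneFold ⟨L * (p'.re - t), p'.im / L⟩)
      ((div_left_inj' hL.ne').1 (sub_right_injective h1))
      (mul_left_cancel₀ hL.ne' (neg_injective h2)))
  obtain ⟨h4, h5⟩ := Complex.ext_iff.1 h3
  simp only at h4 h5
  exact Complex.ext (sub_left_injective (mul_left_cancel₀ hL.ne' h4)) ((div_left_inj' hL.ne').1 h5)

end

/-! ### Shears, stretches and cut-off functions -/

/-- Translate the first factor by `C`, depending on the real part of the second factor. -/
noncomputable def liftShear (C : ℝ → ℝ) (z : ℂ × ℂ) : ℂ × ℂ :=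
  (⟨z.1.re + C z.2.re, z.1.im⟩, ⟨z.2.re, z.2.im - deriv C z.2.re * z.1.im⟩)

theorem preservesAt_liftShear {C : ℝ → ℝ} (hC : ContDiff ℝ ∞ C) (z : ℂ × ℂ) :
    PreservesAt prodForm (liftShear C) z := by
  have hC' : ContDiff ℝ ∞ (deriv C) := (contDiff_infty_iff_deriv.1 hC).2
  have re1 := contDiff_re.comp (contDiff_fst (E := ℂ) (F := ℂ) (𝕜 := ℝ))
  have im1 := contDiff_im.comp (contDiff_fst (E := ℂ) (F := ℂ) (𝕜 := ℝ))
  have re2 := contDiff_re.comp (contDiff_snd (E := ℂ) (F := ℂ) (𝕜 := ℝ))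
  have im2 := contDiff_im.comp (contDiff_snd (E := ℂ) (F := ℂ) (𝕜 := ℝ))
  have dre1 := (hasFDerivAt_re z.1).comp z hasFDerivAt_fst
  have dim1 := (hasFDerivAt_im z.1).comp z hasFDerivAt_fst
  have dre2 := (hasFDerivAt_re z.2).comp z hasFDerivAt_snd
  have dim2 := (hasFDerivAt_im z.2).comp z hasFDerivAt_snd
  have dC := (hC.differentiable (by simp) z.2.re).hasDerivAt.comp_hasFDerivAt z dre2
  have dC' := (hC'.differentiable (by simp) z.2.re).hasDerivAt.comp_hasFDerivAt z dre2
  refine .of_hasFDerivAt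
    ((contDiffAt_mk (re1.add (hC.comp re2)).contDiffAt im1.contDiffAt).prodMk
      (contDiffAt_mk re2.contDiffAt (im2.sub ((hC'.comp re2).mul im1)).contDiffAt))
    ((hasFDerivAt_mk (dre1.add dC) dim1).prodMk
      (hasFDerivAt_mk dre2 (dim2.sub (dC'.mul dim1)))) fun v w => ?_
  simp only [prodForm, areaForm, ContinuousLinearMap.prod_apply, mk_clm_re, mk_clm_im]
  simp
  ring

/-- Stretch the real part by `f`, and squeeze the imaginary part correspondingly. -/
noncomputable def stretch (f : ℝ → ℝ) (p : ℂ) : ℂ := ⟨f p.re, p.im / deriv f p.re⟩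

theorem preservesAt_stretch {f : ℝ → ℝ} (hf : ContDiff ℝ ∞ f) {p : ℂ} (hp : 0 < deriv f p.re) :
    PreservesAt areaForm (stretch f) p := by
  have hf' : ContDiff ℝ ∞ (deriv f) := (contDiff_infty_iff_deriv.1 hf).2
  have df := (hf.differentiable (by simp) p.re).hasDerivAt.comp_hasFDerivAt p (hasFDerivAt_re p)
  have df' := (hf'.differentiable (by simp) p.re).hasDerivAt.comp_hasFDerivAt p (hasFDerivAt_re p)
  refine preservesAt_mk (hf.comp contDiff_re).contDiffAt
    (contDiff_im.contDiffAt.div (hf'.comp contDiff_re).contDiffAt hp.ne') df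
    ((hasFDerivAt_im p).mul ((hasDerivAt_inv hp.ne').comp_hasFDerivAt p df')) fun v w => ?_
  simp
  field_simp
  ring

/-- A smooth decreasing function with value `h` on `(-∞, p]` and `0` on `[q, ∞)`. -/
theorem exists_smooth_step {h p q : ℝ} (hh : 0 < h) (hpq : p < q) :
    ∃ C : ℝ → ℝ, ContDiff ℝ ∞ C ∧ (∀ u, 0 ≤ C u) ∧ (∀ u, deriv C u ≤ 0) ∧
      (∀ u ≤ p, C u = h) ∧ (∀ u, q ≤ u → C u = 0) ∧ ∀ u, q < u → deriv C u = 0 := by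
  have hd : 0 < q - p := sub_pos.2 hpq
  have h0 : ∀ u, q ≤ u → h * Real.smoothTransition ((q - u) / (q - p)) = 0 := fun u hu => by
    rw [Real.smoothTransition.zero_of_nonpos (div_nonpos_of_nonpos_of_nonneg (by linarith) hd.le),
      mul_zero]
  refine ⟨fun u => h * Real.smoothTransition ((q - u) / (q - p)), ?_, fun u => ?_, fun u => ?_,
    fun u hu => ?_, h0, fun u hu => ?_⟩
  · exact contDiff_const.mul (Real.smoothTransition.contDiff.comp
      ((contDiff_const.sub contDiff_id).div_const _))
  · exact mul_nonneg hh.le (Real.smoothTransition.nonneg _)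
  · refine Antitone.deriv_nonpos fun x y hxy => ?_
    exact mul_le_mul_of_nonneg_left (Real.smoothTransition.monotone
      (div_le_div_of_nonneg_right (by linarith) hd.le)) hh.le
  · simp only
    rw [Real.smoothTransition.one_of_one_le ((one_le_div hd).2 (by linarith)), mul_one]
  · have : (fun u => h * Real.smoothTransition ((q - u) / (q - p))) =ᶠ[nhds u] fun _ => 0 :=
      Filter.eventually_of_mem (Ioi_mem_nhds hu) fun x hx => h0 x (le_of_lt hx)
    rw [this.deriv_eq, deriv_const]

/-- A smooth increasing function, with slope `1` on `[q + d, r]` and at most `1` elsewhere, which is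
constant outside `[q, r + d]`. -/
theorem exists_smooth_ramp {q d r : ℝ} (hd : 0 < d) (hr : q + d ≤ r) :
    ∃ B : ℝ → ℝ, ContDiff ℝ ∞ B ∧ (∀ u, 0 ≤ deriv B u) ∧ (∀ u ≤ q, B u = 0) ∧
      (∀ u, B u ≤ r + d - q) ∧ B (q + d) ≤ d ∧ r - (q + d) ≤ B r - B (q + d) ∧
      ∀ u, q + d ≤ u → u ≤ r → deriv B u = 1 := by
  let β : ℝ → ℝ := fun u =>
    Real.smoothTransition ((u - q) / d) * Real.smoothTransition ((r + d - u) / d)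
  have hβ : ContDiff ℝ ∞ β := (Real.smoothTransition.contDiff.comp
      ((contDiff_id.sub contDiff_const).div_const _)).mul (Real.smoothTransition.contDiff.comp
      ((contDiff_const.sub contDiff_id).div_const _))
  have hc : Continuous β := hβ.continuous
  have h0 : ∀ u, 0 ≤ β u := fun u =>
    mul_nonneg (Real.smoothTransition.nonneg _) (Real.smoothTransition.nonneg _)
  have h1 : ∀ u, β u ≤ 1 := fun u =>
    mul_le_one₀ (Real.smoothTransition.le_one _) (Real.smoothTransition.nonneg _)
      (Real.smoothTransition.le_one _)
  have hl : ∀ u ≤ q, β u = 0 := fun u hu => by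
    simp only [β]
    rw [Real.smoothTransition.zero_of_nonpos (div_nonpos_of_nonpos_of_nonneg (by linarith) hd.le),
      zero_mul]
  have hg : ∀ u, r + d ≤ u → β u = 0 := fun u hu => by
    simp only [β]
    rw [Real.smoothTransition.zero_of_nonpos (x := (r + d - u) / d)
      (div_nonpos_of_nonpos_of_nonneg (by linarith) hd.le), mul_zero]
  have hm : ∀ u, q + d ≤ u → u ≤ r → β u = 1 := fun u hu hu' => by
    simp only [β]
    rw [Real.smoothTransition.one_of_one_le ((one_le_div hd).2 (by linarith)),
      Real.smoothTransition.one_of_one_le ((one_le_div hd).2 (by linarith)), mul_one]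
  let B : ℝ → ℝ := fun u => ∫ x in q..u, β x
  have hB : ∀ u, HasDerivAt B (β u) u := fun u => (hc.integral_hasStrictDerivAt q u).hasDerivAt
  have dB : deriv B = β := funext fun u => (hB u).deriv
  have ii : ∀ x y, IntervalIntegrable β MeasureTheory.volume x y := fun x y =>
    hc.intervalIntegrable x y
  have bound : ∀ x y, x ≤ y → ∫ s in x..y, β s ≤ y - x := fun x y hxy => by
    have := intervalIntegral.integral_mono_on hxy (ii x y)
      (continuous_const.intervalIntegrable x y) fun s _ => h1 s
    simpa using this
  have hmono : Monotone B := monotone_of_deriv_nonneg (fun u => (hB u).differentiableAt)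
    fun u => by rw [dB]; exact h0 u
  refine ⟨B, contDiff_infty_iff_deriv.2 ⟨fun u => (hB u).differentiableAt, dB ▸ hβ⟩,
    fun u => dB ▸ h0 u, fun u hu => ?_, fun u => ?_, ?_, ?_, fun u hu hu' => dB ▸ hm u hu hu'⟩
  · have : ∫ x in q..u, β x = ∫ x in q..u, (0 : ℝ) :=
      intervalIntegral.integral_congr fun x hx => hl x (by
        rw [Set.uIcc_of_ge hu] at hx; exact hx.2)
    simp [B, this]
  · rcases le_total u (r + d) with h | h
    · exact (hmono h).trans (bound q (r + d) (by linarith))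
    · have e1 : ∫ x in (r + d)..u, β x = ∫ x in (r + d)..u, (0 : ℝ) :=
        intervalIntegral.integral_congr fun x hx => hg x (by
          rw [Set.uIcc_of_le h] at hx; exact hx.1)
      have e2 := intervalIntegral.integral_add_adjacent_intervals (ii q (r + d)) (ii (r + d) u)
      rw [e1] at e2
      simp only [B]
      rw [← e2]
      simpa using bound q (r + d) (by linarith)
  · simpa using bound q (q + d) (by linarith)
  · have e1 : ∫ x in (q + d)..r, β x = ∫ x in (q + d)..r, (1 : ℝ) :=
      intervalIntegral.integral_congr fun x hx => by
        rw [Set.uIcc_of_le hr] at hx; exact hm x hx.1 hx.2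
    have e2 := intervalIntegral.integral_interval_sub_left (ii q r) (ii q (q + d))
    simp only [B]
    rw [e2, e1]
    simp

/-! ### The folding map -/

/-- The base of the folding map: a stretching of the interval by a lift `C` of height `b / 2`
located near `c / 2`, followed by a long thin piece of width less than `1 / N`. -/
theorem exists_fold_profile {b c ε : ℝ} (hb : 0 < b) (hbc : 2 * b < c) (hε : 0 < ε) :
    ∃ (e p s r t δ N L : ℝ) (C f : ℝ → ℝ), 0 < e ∧ 0 < δ ∧ δ ≤ 1 ∧ N * δ = 2 ∧ 0 < L ∧
      ContDiff ℝ ∞ C ∧ ContDiff ℝ ∞ f ∧ (∀ u, 0 ≤ C u) ∧ (∀ u, deriv C u ≤ 0) ∧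
      (∀ u ≤ p, C u = b / 2) ∧ p < s ∧ s ≤ r ∧
      (∀ u, s ≤ u → C u = 0) ∧ (∀ u, s ≤ u → deriv C u = 0) ∧
      (∀ u, (1 + δ) * (1 - deriv C u) ≤ deriv f u) ∧
      (∀ u, s ≤ u → u ≤ r → N < deriv f u) ∧
      f 0 = 0 ∧ f s = t ∧
      2 * e + b * (1 - p / c) ≤ b / 2 ∧
      (∀ u, 0 < u → u ≤ s → C u + f u + 2 / L ^ 2 + (2 * e + b * (1 - u / c)) ≤
        c / 2 + b + ε) ∧
      (∀ u, s ≤ u → t + 2 / L ^ 2 + (2 * e + b * (1 - u / c)) ≤ c / 2 + b + ε) ∧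
      f (c + e) ≤ 2 * t ∧ 2 * t - f r + 2 / L ^ 2 ≤ f p := by
  have hc : 0 < c := by linarith
  -- All later errors are small fractions of κ.
  obtain ⟨κ, hκ, hκε⟩ : ∃ κ : ℝ, 0 < κ ∧ 2 * κ ≤ ε := ⟨ε / 2, by positivity, by linarith⟩
  obtain ⟨δ, hδ, hδ1, hδκ⟩ : ∃ δ : ℝ, 0 < δ ∧ δ ≤ 1 ∧ δ * (c + b + 3 * κ) ≤ κ / 8 := by
    refine ⟨min 1 (κ / 8 / (c + b + 3 * κ)), by positivity, min_le_left _ _, ?_⟩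
    rw [← le_div_iff₀ (by positivity)]
    exact min_le_right _ _
  obtain ⟨N, hN, hNδ⟩ : ∃ N : ℝ, 2 ≤ N ∧ N * δ = 2 :=
    ⟨2 / δ, by rw [le_div_iff₀ hδ]; linarith, div_mul_cancel₀ _ hδ.ne'⟩
  have hN0 : 0 < N := by linarith
  obtain ⟨η, hη, hηκ⟩ : ∃ η : ℝ, 0 < η ∧ η = κ / 16 := ⟨κ / 16, by positivity, rfl⟩
  obtain ⟨θ, hθ, hNθ⟩ : ∃ θ : ℝ, 0 < θ ∧ N * θ = κ / 16 :=
    ⟨κ / 16 / N, by positivity, mul_div_cancel₀ _ hN0.ne'⟩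
  have hθκ : θ ≤ κ / 16 := by nlinarith
  obtain ⟨L, hL, hLκ⟩ : ∃ L : ℝ, 0 < L ∧ 2 / L ^ 2 ≤ κ / 16 := by
    refine ⟨32 / κ + 1, by positivity, ?_⟩
    have h1 : 0 < 32 / κ := by positivity
    have h2 : 32 / κ * κ = 32 := div_mul_cancel₀ _ hκ.ne'
    rw [div_le_iff₀ (by positivity)]
    have h3 : κ / 16 * (32 / κ + 1) ^ 2 = 2 * (32 / κ) + 4 + κ / 16 := by field_simp; ring
    linarith
  obtain ⟨β, hβ, hβ1, hβc⟩ : ∃ β : ℝ, 0 < β ∧ β < 1 ∧ c * β = b :=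
    ⟨b / c, by positivity, by rw [div_lt_one hc]; linarith, mul_div_cancel₀ _ hc.ne'⟩
  have hβu : ∀ u, b * (1 - u / c) = b - u * β := fun u => by
    rw [← hβc]; field_simp
  obtain ⟨e, he, heβ⟩ : ∃ e : ℝ, 0 < e ∧ e = κ * β / 16 := ⟨κ * β / 16, by positivity, rfl⟩
  have heκ : e ≤ κ / 16 := by nlinarith
  -- The thin piece gets stretched length at least b/2 + κ, so that when folded back it covers the
  -- base added by the descending lift. The thick part beyond it then lands to the left of f(p).
  obtain ⟨ℓ, hℓ, hNℓ⟩ : ∃ ℓ : ℝ, 0 < ℓ ∧ N * ℓ = b / 2 + κ :=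
    ⟨(b / 2 + κ) / N, by positivity, mul_div_cancel₀ _ hN0.ne'⟩
  -- Starting the descent κ beyond c/2 makes b(1 - p/c) smaller than b/2 by κβ = 16e, which absorbs
  -- the fibre error 2e. It also adds 2κ to 2t, giving room for f(c + e) ≤ 2t.
  obtain ⟨p, hp⟩ : ∃ p, p = c / 2 + κ := ⟨_, rfl⟩
  obtain ⟨q, hq⟩ : ∃ q, q = p + η := ⟨_, rfl⟩
  obtain ⟨s, hs⟩ : ∃ s, s = q + θ := ⟨_, rfl⟩
  obtain ⟨r, hr⟩ : ∃ r, r = s + ℓ := ⟨_, rfl⟩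
  obtain ⟨C, hC, hC0, dC, hCp, hCq, dCq⟩ :=
    exists_smooth_step (h := b / 2) (p := p) (q := q) (by positivity) (by linarith)
  obtain ⟨B, hB, dB, hBq, hBle, hBs, hBr, dBs⟩ :=
    exists_smooth_ramp (q := q) (d := θ) (r := r) hθ (by linarith)
  rw [← hs] at hBs hBr dBs
  have hBmono : Monotone B := monotone_of_deriv_nonneg (hB.differentiable (by simp)) dB
  -- Slope at least (1 + δ)(1 - C') compensates the shear, whose image has height below 1 - C'. The
  -- term N B creates the thin piece.
  let f : ℝ → ℝ := fun u => (1 + δ) * (u + b / 2 - C u) + N * B u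
  have df : ∀ u, deriv f u = (1 + δ) * (1 - deriv C u) + N * deriv B u := fun u =>
    (((((hasDerivAt_id u).add_const (b / 2)).sub
      (hC.differentiable (by simp) u).hasDerivAt).const_mul (1 + δ)).add
      ((hB.differentiable (by simp) u).hasDerivAt.const_mul N)).deriv
  have hCs : C s = 0 := hCq s (by linarith)
  have hBs0 : 0 ≤ B s := by rw [← hBq q le_rfl]; exact hBmono (by linarith)
  have hNBs : N * B s ≤ κ / 16 := hNθ ▸ mul_le_mul_of_nonneg_left hBs hN0.le
  have hδs : δ * (s + b / 2) ≤ κ / 8 :=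
    (mul_le_mul_of_nonneg_left (by linarith) hδ.le).trans hδκ
  have hδb : δ * (b / 2) ≤ κ / 8 :=
    (mul_le_mul_of_nonneg_left (by linarith) hδ.le).trans hδκ
  have hfs : f s = (1 + δ) * (s + b / 2) + N * B s := by simp only [f, hCs]; ring
  have hsβ : s * (1 - β) ≤ c / 2 - b / 2 + (κ + η + θ) := by
    have h1 : s * (1 - β) = c / 2 - b / 2 + (κ + η + θ) - (κ + η + θ) * β := by
      rw [hs, hq, hp]; linear_combination -hβc / 2
    have h2 : 0 ≤ (κ + η + θ) * β := by positivity
    linarith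
  refine ⟨e, p, s, r, f s, δ, N, L, C, f, he, hδ, hδ1, hNδ, hL, hC, ?_, hC0, dC, hCp,
    by linarith, by linarith, fun u hu => hCq u (by linarith), fun u hu => dCq u (by linarith),
    fun u => ?_, fun u hu hu' => ?_, ?_, rfl, ?_, fun u hu hu' => ?_, fun u hu => ?_, ?_, ?_⟩
  · exact (contDiff_const.mul ((contDiff_id.add contDiff_const).sub hC)).add
      (contDiff_const.mul hB)
  · rw [df]; linarith [mul_nonneg hN0.le (dB u)]
  · rw [df, dBs u hu hu', dCq u (by linarith)]; linarith
  · simp only [f]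
    rw [hCp 0 (by linarith), hBq 0 (by linarith)]
    ring
  · have h1 : p * β = b / 2 + κ * β := by rw [hp]; linear_combination hβc / 2
    have h2 := mul_pos hκ hβ
    rw [hβu]
    linarith
  · have h1 : N * B u ≤ N * B s := mul_le_mul_of_nonneg_left (hBmono hu') hN0.le
    have h2 : u * (1 - β) ≤ s * (1 - β) := mul_le_mul_of_nonneg_right hu' (by linarith)
    have h3 : δ * (u + b / 2 - C u) ≤ δ * (s + b / 2) :=
      mul_le_mul_of_nonneg_left (by linarith [hC0 u]) hδ.le
    rw [hβu]
    simp only [f]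
    linarith
  · have h2 : s * β ≤ u * β := mul_le_mul_of_nonneg_right hu hβ.le
    rw [hβu, hfs]
    linarith
  · have h1 : N * B (c + e) ≤ N * (ℓ + θ + θ) :=
      mul_le_mul_of_nonneg_left ((hBle _).trans (by linarith)) hN0.le
    have h2 := hC0 (c + e)
    have h3 : 0 ≤ δ * (2 * s + b / 2 - c - e + C (c + e)) := mul_nonneg hδ.le (by linarith)
    have h4 := mul_nonneg hN0.le hBs0
    rw [hfs]
    simp only [f]
    linarith
  · have h1 : N * ℓ ≤ N * (B r - B s) :=
      mul_le_mul_of_nonneg_left (by linarith) hN0.le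
    rw [hfs]
    simp only [f]
    rw [hCq r (by linarith), hCp p le_rfl, hBq p (by linarith)]
    have h2 : δ * (2 * s + b / 2 - r - p) ≤ δ * (b / 2) + δ * (η + θ) := by
      rw [← mul_add]; exact mul_le_mul_of_nonneg_left (by linarith) hδ.le
    have h3 : δ * (η + θ) ≤ 1 * (η + θ) := mul_le_mul_of_nonneg_right hδ1 (by positivity)
    linarith

/-- The product of two strips which contains the ellipsoid in strip coordinates, up to `e`. -/
def foldDomain (b c e : ℝ) : Set (ℂ × ℂ) :=
  {z | 0 < z.1.re ∧ (0 < z.1.im ∧ z.1.im < 1) ∧ (0 < z.2.re ∧ z.2.re < c + e) ∧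
    (0 < z.2.im ∧ z.2.im < 1) ∧ z.1.re < 2 * e + b * (1 - z.2.re / c)}

/-- Symplectic folding in strip coordinates. -/
theorem exists_fold_map {b c ε : ℝ} (hb : 0 < b) (hbc : 2 * b < c) (hε : 0 < ε) :
    ∃ (e : ℝ) (M : ℂ × ℂ → ℂ × ℂ), 0 < e ∧
      (∀ z ∈ foldDomain b c e, PreservesAt prodForm M z ∧ 0 < (M z).1.re ∧
        (M z).1.im = z.1.im ∧ 0 < (M z).2.re ∧
        (M z).1.re + (M z).2.re + (2 * e + b * (1 - z.2.re / c) - z.1.re) ≤ c / 2 + b + ε) ∧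
      ∀ z ∈ foldDomain b c e, ∀ z' ∈ foldDomain b c e, (M z).1 = (M z').1 →
        (M z).2.re = (M z').2.re → (∃ m : ℤ, (M z).2.im = (M z').2.im + m) → z = z' := by
  have hc : 0 < c := by linarith
  obtain ⟨e, p, s, r, t, δ, N, L, C, f, he, hδ, hδ1, hNδ, hL, hC, hf, hC0, dC, hCp, hps, hsr, hCs,
    dCs, df1, df2, f0, fs, hep, hu1, hu2, hft, hfr⟩ := exists_fold_profile hb hbc hε
  have hN : 0 < N := by nlinarith
  have df0 : ∀ u, 0 < deriv f u := fun u => lt_of_lt_of_le (by nlinarith [dC u]) (df1 u)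
  have fmono : StrictMono f := strictMono_of_deriv_pos df0
  have dfs := fun u => (hf.differentiable (by simp) u).hasDerivAt
  let S : ℂ × ℂ → ℂ := fun z => stretch f (liftShear C z).2
  have hSre : ∀ z : ℂ × ℂ, (S z).re = f z.2.re := fun z => rfl
  have hSim : ∀ z : ℂ × ℂ, (S z).im * deriv f z.2.re = z.2.im - deriv C z.2.re * z.1.im :=
    fun z => div_mul_cancel₀ _ (df0 _).ne'
  have hSpos : ∀ z ∈ foldDomain b c e, 0 < (S z).im := by
    rintro z ⟨-, hy, -, hv, -⟩
    have h1 : 0 < z.2.im - deriv C z.2.re * z.1.im := by nlinarith [dC z.2.re]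
    exact div_pos h1 (df0 _)
  have hSlt : ∀ z ∈ foldDomain b c e, (1 + δ) * (S z).im < 1 := by
    rintro z hz
    have hw := hSpos z hz
    obtain ⟨-, hy, -, hv, -⟩ := hz
    have h1 : (S z).im * deriv f z.2.re < 1 - deriv C z.2.re := by
      rw [hSim]; nlinarith [dC z.2.re]
    have h2 := mul_le_mul_of_nonneg_left (df1 z.2.re) hw.le
    by_contra! h
    nlinarith [dC z.2.re]
  have hSthin : ∀ z ∈ foldDomain b c e, s ≤ z.2.re → z.2.re ≤ r → N * (S z).im < 1 := by
    rintro z hz hu hu'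
    have hw := hSpos z hz
    obtain ⟨-, hy, -, hv, -⟩ := hz
    have h1 := hSim z
    rw [dCs _ hu, zero_mul, sub_zero] at h1
    have h2 := mul_lt_mul_of_pos_left (df2 z.2.re hu hu') hw
    linarith
  have hSlt1 : ∀ z ∈ foldDomain b c e, (S z).im < 1 := fun z hz => by
    nlinarith [hSpos z hz, hSlt z hz]
  have hL2 : 0 < 2 / L ^ 2 := by positivity
  let M : ℂ × ℂ → ℂ × ℂ := fun z => ((liftShear C z).1, stripFold t L (S z))
  have hMre : ∀ z : ℂ × ℂ, (M z).1.re = z.1.re + C z.2.re := fun z => rfl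
  have hMle : ∀ z ∈ foldDomain b c e, (M z).2.re ≤ t - |f z.2.re - t| + 2 / L ^ 2 := fun z hz => by
    have h1 : (M z).2.re ≤ _ := re_stripFold_le (t := t) hL (hSpos z hz)
    rw [hSre] at h1
    have h2 := mul_le_mul_of_nonneg_left (hSlt1 z hz).le hL2.le
    linarith
  have hleM : ∀ z : ℂ × ℂ, t - |f z.2.re - t| ≤ (M z).2.re := fun z =>
    le_re_stripFold (t := t) (p := S z) hL
  -- Here z lies left of the fold and z' right of it, and their heights before folding sum to more
  -- than 1. This rules out the thin piece, where the heights are below 1 - δ/2 and δ/2. Beyond it,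
  -- either z is fully lifted and the fibres are disjoint, or z lies over u > p and the real parts
  -- in the base differ.
  have no_overlap : ∀ z ∈ foldDomain b c e, ∀ z' ∈ foldDomain b c e,
      (M z).1.re = (M z').1.re → (M z).2.re = (M z').2.re →
      (M z).2.im = (M z').2.im + 1 → False := by
    intro z hz z' hz' h1 h2 h3
    have hw := hSpos z hz
    have hw' := hSpos z' hz'
    have hV := abs_lt.1 (abs_im_stripFold_lt (t := t) hL hw)
    have hV' := abs_lt.1 (abs_im_stripFold_lt (t := t) hL hw')
    change -_ < (M z).2.im ∧ (M z).2.im < _ at hV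
    change -_ < (M z').2.im ∧ (M z').2.im < _ at hV'
    have hlt := hSlt z hz
    have hlt1 := hSlt1 z hz
    have hlt1' := hSlt1 z' hz'
    have hpos : f z.2.re < t := (im_stripFold_pos_iff (t := t) hL hw).1 (by
      change 0 < (M z).2.im; linarith)
    have hneg : t < f z'.2.re := (im_stripFold_neg_iff (t := t) hL hw').1 (by
      change (M z').2.im < 0; linarith)
    have hu : z.2.re < s := fmono.lt_iff_lt.1 (fs.symm ▸ hpos)
    have hu' : s < z'.2.re := fmono.lt_iff_lt.1 (fs.symm ▸ hneg)
    have hur : r < z'.2.re := by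
      by_contra! h
      have h4 := hSthin z' hz' hu'.le h
      have h5 : (S z).im < 1 - δ / 2 := by nlinarith
      have h6 : (S z').im < δ / 2 := by nlinarith
      linarith
    have hCz' := hCs _ hu'.le
    rcases le_or_gt z.2.re p with hup | hup
    · rw [hMre, hMre, hCp _ hup, hCz'] at h1
      obtain ⟨hx, -⟩ := hz
      obtain ⟨-, -, -, -, hx'⟩ := hz'
      have h7 : b * (1 - z'.2.re / c) ≤ b * (1 - p / c) := by
        have : p / c ≤ z'.2.re / c := div_le_div_of_nonneg_right (by linarith) hc.le
        exact mul_le_mul_of_nonneg_left (by linarith) hb.le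
      linarith
    · have h4 := hleM z
      have h5 := hMle z' hz'
      rw [abs_of_neg (by linarith)] at h4
      rw [abs_of_pos (by linarith)] at h5
      have h6 := fmono hup
      have h7 := fmono hur
      linarith
  refine ⟨e, M, he, fun z hz => ⟨?_, ?_, rfl, ?_, ?_⟩, fun z hz z' hz' h1 h2 ⟨m, hm⟩ => ?_⟩
  · have hid : ∀ p, PreservesAt areaForm (fun p : ℂ => p) p := fun p =>
      .of_hasFDerivAt contDiffAt_id (hasFDerivAt_id p) fun v w => rfl
    exact ((hid _).prodMap ((preservesAt_stripFold hL (hSpos z hz)).comp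
      (preservesAt_stretch hf (df0 _)))).comp (preservesAt_liftShear hC z)
  · rw [hMre]; linarith [hC0 z.2.re, hz.1]
  · have h1 := hleM z
    obtain ⟨-, -, ⟨hu, hu'⟩, -, -⟩ := hz
    have h2 := fmono hu
    have h3 := fmono hu'
    rw [f0] at h2
    rcases abs_cases (f z.2.re - t) with ⟨h, _⟩ | ⟨h, _⟩ <;> rw [h] at h1 <;> linarith
  · have h1 := hMle z hz
    obtain ⟨-, -, ⟨hu, -⟩, -, -⟩ := hz
    rw [hMre]
    rcases le_total z.2.re s with h | h
    · have := hu1 _ hu h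
      have := neg_abs_le (f z.2.re - t)
      linarith
    · have := hu2 _ h
      have := abs_nonneg (f z.2.re - t)
      rw [hCs _ h]
      linarith
  · have hV := abs_lt.1 (abs_im_stripFold_lt (t := t) hL (hSpos z hz))
    have hV' := abs_lt.1 (abs_im_stripFold_lt (t := t) hL (hSpos z' hz'))
    change -_ < (M z).2.im ∧ (M z).2.im < _ at hV
    change -_ < (M z').2.im ∧ (M z').2.im < _ at hV'
    have hlt := hSlt1 z hz
    have hlt' := hSlt1 z' hz'
    have hm1 : (m : ℝ) < 2 := by linarith
    have hm2 : (-2 : ℝ) < m := by linarith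
    have hm1' : m < 2 := by exact_mod_cast hm1
    have hm2' : -2 < m := by exact_mod_cast hm2
    -- Imaginary parts of modulus below 1 leave only these shifts; the zero shift reduces to
    -- injectivity of the strip fold.
    obtain rfl | rfl | rfl : m = -1 ∨ m = 0 ∨ m = 1 := by omega
    · exact (no_overlap z' hz' z hz (by rw [h1]) h2.symm (by push_cast at hm; linarith)).elim
    · have h3 : S z = S z' := stripFold_injOn (t := t) hL (Set.mem_ofPred_eq ▸ hSpos z hz)
        (Set.mem_ofPred_eq ▸ hSpos z' hz') (Complex.ext h2 (by simpa using hm))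
      have h4 : z.2.re = z'.2.re := fmono.injective (Complex.ext_iff.1 h3).1
      have h5 : z.1.im = z'.1.im := (Complex.ext_iff.1 h1).2
      have h6 := hSim z
      rw [h3, h4, hSim, h5] at h6
      have h7 := (Complex.ext_iff.1 h1).1
      rw [hMre, hMre, h4] at h7
      exact Prod.ext (Complex.ext (by linarith) h5) (Complex.ext h4 (by linarith))
    · exact (no_overlap z hz z' hz' (by rw [h1]) h2 (by push_cast at hm; linarith)).elim

/-! ### Embedding the ellipsoid -/

theorem ellipsoidLast_embeds_ball {n : ℕ} (hn : 2 ≤ n) {b c ε : ℝ} (hb : 0 < b) (hbc : 2 * b < c)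
    (hε : 0 < ε) : SymplecticallyEmbeds (ellipsoidLast n b c) (ball n (c / 2 + b + ε)) := by
  have hpi := Real.pi_pos
  have hc : 0 < c := by linarith
  obtain ⟨e, M, he, hM, hinj⟩ := exists_fold_map hb hbc hε
  have hR : 0 ≤ √(c / Real.pi) := Real.sqrt_nonneg _
  obtain ⟨P, hP, hPinj, hPb⟩ := exists_strip_coordinate hR he
  let i : Fin n := ⟨0, by omega⟩
  let j : Fin n := ⟨n - 1, by omega⟩
  have hij : i ≠ j := by simp [i, j, Fin.ext_iff]; omega
  let Ψ : ℂ × ℂ → ℂ × ℂ := fun z => M (P z.1, P z.2)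
  let Φ : ℂ × ℂ → ℂ × ℂ := fun z => (ofPolar (Ψ z).1, ofPolar (Ψ z).2)
  have hA : 0 < c / 2 + b + ε := by positivity
  have hz_sum : ∀ z ∈ ellipsoidLast n b c, Real.pi * ‖z i‖ ^ 2 +
      ∑ k ∈ (Finset.univ.erase i).erase j, Real.pi * ‖z k‖ ^ 2 <
        b * (1 - Real.pi * ‖z j‖ ^ 2 / c) := by
    intro z hz
    simp only [ellipsoidLast, ellipsoid, Set.mem_ofPred_eq] at hz
    rw [sum_eq_add_add hij, if_neg (by simp [i]; omega), if_pos (by simp [j]; omega),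
      Finset.sum_congr rfl (g := fun k => Real.pi * ‖z k‖ ^ 2 / b) fun k hk => by
        have hkj : k ≠ j := (Finset.mem_erase.1 hk).1
        rw [if_neg fun h => hkj (Fin.ext (by simp [j]; omega))], ← Finset.sum_div] at hz
    have h1 : (Real.pi * ‖z i‖ ^ 2 + ∑ k ∈ (Finset.univ.erase i).erase j, Real.pi * ‖z k‖ ^ 2) / b <
        1 - Real.pi * ‖z j‖ ^ 2 / c := by
      rw [add_div]; linarith
    rwa [div_lt_iff₀' hb] at h1
  have hrest : ∀ z : Fin n → ℂ,
      0 ≤ ∑ k ∈ (Finset.univ.erase i).erase j, Real.pi * ‖z k‖ ^ 2 := fun z =>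
    Finset.sum_nonneg fun k _ => by positivity
  have hdom : ∀ z ∈ ellipsoidLast n b c, (P (z i)).re +
      ∑ k ∈ (Finset.univ.erase i).erase j, Real.pi * ‖z k‖ ^ 2 <
        2 * e + b * (1 - (P (z j)).re / c) ∧ (P (z i), P (z j)) ∈ foldDomain b c e := by
    intro z hz
    have h1 := hz_sum z hz
    have h2 := hrest z
    have hi : 0 ≤ Real.pi * ‖z i‖ ^ 2 := by positivity
    have hj : 0 ≤ Real.pi * ‖z j‖ ^ 2 / c := by positivity
    have h3 : 0 < 1 - Real.pi * ‖z j‖ ^ 2 / c := pos_of_mul_pos_right (by linarith) hb.le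
    have hjc : Real.pi * ‖z j‖ ^ 2 < c := by rw [sub_pos, div_lt_one hc] at h3; exact h3
    have hic : Real.pi * ‖z i‖ ^ 2 ≤ c := by nlinarith
    have hnorm : ∀ w : ℂ, Real.pi * ‖w‖ ^ 2 ≤ c → ‖w‖ ≤ √(c / Real.pi) := fun w hw =>
      Real.le_sqrt_of_sq_le (by rw [le_div_iff₀' hpi]; exact hw)
    obtain ⟨a1, a2, a3, a4⟩ := hPb (z i)
    obtain ⟨b1, b2, b3, b4⟩ := hPb (z j)
    have a5 := a4 (hnorm _ hic)
    have b5 := b4 (hnorm _ hjc.le)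
    -- One e comes from the fibre coordinate; the base coordinate costs b e / c ≤ e. Together they
    -- give the 2e in `foldDomain`.
    have h5 : b * (1 - Real.pi * ‖z j‖ ^ 2 / c) ≤ e + b * (1 - (P (z j)).re / c) := by
      have h6 : (P (z j)).re / c ≤ Real.pi * ‖z j‖ ^ 2 / c + e / c := by
        rw [← add_div]; exact div_le_div_of_nonneg_right b5 hc.le
      have h7 : b * (e / c) ≤ e := by
        rw [mul_div_assoc', div_le_iff₀ hc]; nlinarith
      nlinarith
    have h8 : (P (z i)).re + ∑ k ∈ (Finset.univ.erase i).erase j, Real.pi * ‖z k‖ ^ 2 <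
        2 * e + b * (1 - (P (z j)).re / c) := by linarith
    exact ⟨h8, a1, ⟨a2, a3⟩, ⟨b1, by simp only; linarith⟩, ⟨b2, b3⟩, by simp only; linarith⟩
  refine ⟨liftPair i j Φ, isSymplecticEmbedding_of_preservesAt (isOpen_ellipsoid _) ?_ ?_ ?_⟩
  · intro z hz
    obtain ⟨-, hd⟩ := hdom z hz
    obtain ⟨m1, m2, -, m4, -⟩ := hM _ hd
    refine PreservesAt.liftPair hij ?_
    exact PreservesAt.comp (f := Ψ) ((preservesAt_ofPolar m2).prodMap (preservesAt_ofPolar m4))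
      (PreservesAt.comp (z := (z i, z j)) (f := fun z : ℂ × ℂ => (P z.1, P z.2)) m1
        ((hP _).prodMap (hP _)))
  · intro z hz z' hz' h
    obtain ⟨-, hd⟩ := hdom z hz
    obtain ⟨-, hd'⟩ := hdom z' hz'
    obtain ⟨-, m2, m3, m4, -⟩ := hM _ hd
    obtain ⟨-, m2', m3', m4', -⟩ := hM _ hd'
    have hi : ofPolar (Ψ (z i, z j)).1 = ofPolar (Ψ (z' i, z' j)).1 := by
      simpa [liftPair] using congrFun h i
    have hj : ofPolar (Ψ (z i, z j)).2 = ofPolar (Ψ (z' i, z' j)).2 := by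
      simpa [liftPair, hij.symm] using congrFun h j
    obtain ⟨e1, m, e2⟩ := ofPolar_eq_iff m2 m2' hi
    obtain ⟨e3, e4⟩ := ofPolar_eq_iff m4 m4' hj
    have hm : m = 0 := by
      obtain ⟨-, ⟨y1, y2⟩, -⟩ := hd
      obtain ⟨-, ⟨y1', y2'⟩, -⟩ := hd'
      rw [m3, m3'] at e2
      simp only at e2 y1 y2 y1' y2'
      have h1 : (m : ℝ) < 1 := by linarith
      have h2 : (-1 : ℝ) < m := by linarith
      have h1' : m < 1 := by exact_mod_cast h1
      have h2' : -1 < m := by exact_mod_cast h2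
      omega
    have heq := hinj _ hd _ hd' (Complex.ext e1 (by simpa [hm] using e2)) e3 e4
    funext k
    by_cases hki : k = i
    · rw [hki]; exact hPinj (Prod.ext_iff.1 heq).1
    by_cases hkj : k = j
    · rw [hkj]; exact hPinj (Prod.ext_iff.1 heq).2
    simpa [liftPair, hki, hkj] using congrFun h k
  -- The slack 2e + b(1 - u/c) - x in the folding estimate exceeds the total action of the untouched
  -- coordinates.
  · intro z hz
    obtain ⟨h1, hd⟩ := hdom z hz
    obtain ⟨-, m2, -, m4, m5⟩ := hM _ hd
    simp only [ball, ellipsoid, Set.mem_ofPred_eq]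
    rw [← Finset.sum_div, div_lt_one hA, sum_eq_add_add hij]
    have hi : liftPair i j Φ z i = ofPolar (Ψ (z i, z j)).1 := by simp [liftPair, Φ]
    have hj : liftPair i j Φ z j = ofPolar (Ψ (z i, z j)).2 := by simp [liftPair, hij.symm, Φ]
    rw [hi, hj, norm_ofPolar m2.le, norm_ofPolar m4.le,
      Finset.sum_congr rfl (g := fun k => Real.pi * ‖z k‖ ^ 2) fun k hk => by
        simp only [Finset.mem_erase, Finset.mem_univ, and_true] at hk
        simp [liftPair, hk.1, hk.2]]
    simp only at m5
    linarith

end SymplecticFolding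

theorem mainTheorem2 (n : ℕ) (hn : 2 ≤ n) :
    (∀ a ε : ℝ, 2 * Real.pi < a → 0 < ε →
      SymplecticFolding.SymplecticallyEmbeds
        (SymplecticFolding.ellipsoidLast n Real.pi a)
        (SymplecticFolding.ball n (a / 2 + Real.pi + ε))) ∧
    (∀ b c : ℝ, 0 < b → 2 * b < c →
      ∃ A : ℝ, 0 < A ∧ A < c ∧
        SymplecticFolding.SymplecticallyEmbeds
          (SymplecticFolding.ellipsoidLast n b c)
          (SymplecticFolding.ball n A)) := by
  refine ⟨fun a ε ha hε => SymplecticFolding.ellipsoidLast_embeds_ball hn Real.pi_pos ha hε,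
    -- A is the midpoint of c/2 + b and c.
    fun b c hb hbc => ⟨c / 2 + b + (c / 2 - b) / 2, by linarith, by linarith,
      SymplecticFolding.ellipsoidLast_embeds_ball hn hb hbc (by linarith)⟩⟩
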